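/- Let $U$ be a locally compact Hausdorff space whose one point compactification $U^*=U\cup\{*\}$ carries the structure of a finite CW complex with $*$ as its only $0$-cell. Let $N$ be a finite set with $n\ge 0$ elements. For a subset $S\subseteq U$ let $\mathrm{Conf}_N(S)\subseteq (U^*)^N$ be the space of injective maps $N\to S$, and let $D_N(U)\subseteq (U^*)^N$ be the closed complement of $\mathrm{Conf}_N(U)$, i.e. the set of maps $N\to U^*$ which have $*$ in their image or fail to be injective. For $d\ge 0$, the $d$-skeleton of $U$ is the union of the open cells of $U^*$ contained in $U$ and of dimension at most $d$. Then the pair $((U^*)^N, D_N(U))$ is $(n-1)$-connected: for $0\le i\le n-1$ every map of pairs $(I^i,\partial I^i)\to ((U^*)^N,D_N(U))$ is homotopic relative to $\partial I^i$ to a map into $D_N(U)$. In fact, this pair has the structure of a finite relative cell complex (that is, $(U^*)^N$ is obtained from $D_N(U)$ by attaching finitely many cells one after another, the boundary of each cell being mapped into the union of $D_N(U)$ and the cells attached before it) such that 1. every cell has dimension $\ge n$; 2. the open $n$-cells are precisely the connected components of $\mathrm{Conf}_N(U_1)$, where $U_1$ is the union of the open $1$-cells of $U^*$; 3. for every $d\ge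 0$, every open $(n+d)$-cell is contained in $\mathrm{Conf}_N$ of the $(d+1)$-skeleton of $U$. -/

import Mathlib

open Topology OnePoint

/-- The structure of a finite relative cell complex on the pair `(X, D)`: a finite list of cells
attached to the closed set `D` one after another, in the order of the list. The boundary of each
cell is carried by its characteristic map into the union of `D` and the cells attached earlier;
the dimensions need not be increasing along the list. As for Mathlib's `RelCWComplex`, the
characteristic maps are defined on the closed cube `[-1, 1] ^ m`, the unit ball of `Fin m → ℝ`. -/
structure FiniteRelCellComplex {X : Type*} [TopologicalSpace X] (D : Set X) where
  /-- The number of cells. -/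
  numCells : ℕ
  /-- The dimension of the `i`-th cell. -/
  dim : Fin numCells → ℕ
  /-- The characteristic map of the `i`-th cell. -/
  map : ∀ i : Fin numCells, PartialEquiv (Fin (dim i) → ℝ) X
  source_eq : ∀ i, (map i).source = Metric.ball 0 1
  continuousOn : ∀ i, ContinuousOn (map i) (Metric.closedBall 0 1)
  continuousOn_symm : ∀ i, ContinuousOn (map i).symm (map i).target
  /-- The open cells are pairwise disjoint. -/
  pairwise_disjoint :
    ∀ i j, i ≠ j → Disjoint (map i '' Metric.ball 0 1) (map j '' Metric.ball 0 1)
  /-- The open cells are disjoint from the base. -/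
  disjoint_base : ∀ i, Disjoint (map i '' Metric.ball 0 1) D
  /-- The boundary of a cell lies in the union of the base and the earlier cells. -/
  mapsTo : ∀ i, Set.MapsTo (map i) (Metric.sphere 0 1)
    (D ∪ ⋃ j, ⋃ (_ : j < i), map j '' Metric.closedBall 0 1)
  isClosed_base : IsClosed D
  /-- The topology of `X` is the one determined by the base and the closed cells. -/
  closed : ∀ A : Set X, (∀ i, IsClosed (A ∩ map i '' Metric.closedBall 0 1)) →
    IsClosed (A ∩ D) → IsClosed A
  /-- The base and the closed cells cover `X`. -/
  union : D ∪ ⋃ i, map i '' Metric.closedBall 0 1 = Set.univ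

/-- The open cell with a given index. -/
def FiniteRelCellComplex.openCell {X : Type*} [TopologicalSpace X] {D : Set X}
    (E : FiniteRelCellComplex D) (i : Fin E.numCells) : Set X :=
  E.map i '' Metric.ball 0 1

/-- The pair `(X, A)` is `k`-connected: for every `0 ≤ i ≤ k`, every map of pairs
`(I ^ i, ∂ I ^ i) → (X, A)` is homotopic relative to `∂ I ^ i` to a map into `A`. For `i = 0` this
says that every point of `X` is joined to a point of `A` by a path; for `i > 0` it says that
`π_i (X, A, a)` is trivial for all `a` in `A`. For `k < 0` nothing is required. -/
def IsConnectedPair {X : Type*} [TopologicalSpace X] (A : Set X) (k : ℤ) : Prop :=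
  ∀ i : ℕ, (i : ℤ) ≤ k → ∀ f : C(Metric.closedBall (0 : Fin i → ℝ) 1, X),
    (∀ x, ‖x.1‖ = 1 → f x ∈ A) →
      ∃ g : C(Metric.closedBall (0 : Fin i → ℝ) 1, X),
        (∀ x, g x ∈ A) ∧ f.HomotopicRel g {x | ‖x.1‖ = 1}

/-- `Conf_N (S)`, the set of injective maps from `N` to `S`, as a subset of `X ^ N` for `S ⊆ X`. -/
def Conf (N : Type*) {X : Type*} (S : Set X) : Set (N → X) :=
  {f | Function.Injective f ∧ ∀ a, f a ∈ S}

/-- `D_N (U)`: the set of maps from `N` to the one point compactification of `U` that have the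
added point in their image or fail to be injective. -/
def fatDiagonal (N : Type*) (U : Type*) : Set (N → OnePoint U) :=
  {f | (∃ a, f a = ∞) ∨ ¬ Function.Injective f}

/-- The union of the (open) `1`-cells of the one point compactification of `U`. -/
def unionOneCells (U : Type*) [TopologicalSpace U]
    [CWComplex (Set.univ : Set (OnePoint U))] : Set (OnePoint U) :=
  ⋃ i : RelCWComplex.cell (Set.univ : Set (OnePoint U)) 1, RelCWComplex.openCell 1 i

/-- The `d`-skeleton of `U`, i.e. the `d`-skeleton of its one point compactification without the
added point, as a subset of the one point compactification. -/
def skeletonOf (U : Type*) [TopologicalSpace U] [T2Space U] [LocallyCompactSpace U]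
    [CWComplex (Set.univ : Set (OnePoint U))] (d : ℕ) : Set (OnePoint U) :=
  (RelCWComplex.skeleton (Set.univ : Set (OnePoint U)) (d : ℕ∞) : Set (OnePoint U)) \ {∞}

/-- The set of connected components of a subset `S` of a topological space. -/
def componentsOf {X : Type*} [TopologicalSpace X] (S : Set X) : Set (Set X) :=
  {C | ∃ x ∈ S, C = connectedComponentIn S x}

/-- `D_N (U)` is the complement of `Conf_N (U)`. -/
theorem compl_fatDiagonal (N : Type*) (U : Type*) :
    (fatDiagonal N U)ᶜ = Conf N (Set.range ((↑) : U → OnePoint U)) := by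
  ext f
  have h : ∀ x : OnePoint U, x ∈ Set.range ((↑) : U → OnePoint U) ↔ x ≠ ∞ := fun x => by
    rw [OnePoint.ne_infty_iff_exists]; rfl
  simp only [Conf, fatDiagonal, Set.mem_compl_iff, Set.mem_ofPred_eq, h, not_or, not_exists,
    not_not, ne_eq]
  exact and_comm

/-! Outside the fat diagonal every point of a configuration lies in an open cell of positive
dimension, hence is given by that cell and coordinates in an open cube. Points in the same cell are
compared lexicographically. Recording the cells and, for each pair in a common cell, the order and
the first coordinate that differs splits the configuration space into finitely many types. A type is
cut out by linear equations, strict linear inequalities and the unit cube, so it is an open convex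
polytope in a subspace, that is, an open cell; the product of the characteristic maps extends over
its closure.

At a boundary point that is not degenerate, either some point has dropped into a cell of smaller
dimension, or all points have kept their cells and an inequality has become an equality. In the
first case the total dimension of the occupied cells drops, although the dimension of the new
configuration cell may grow; in the second the spanned subspace shrinks. Hence cells are attached in
lexicographic order of these two numbers (`configMap_sphere`), not by dimension.

The last coordinate of each point is never constrained by an equation, and the leading coordinates
of all points in one `d`-dimensional cell can be moved together. So a type with a point in a
`d`-cell has dimension at least `n + d - 1` (`card_add_dim_le_finrank`). This gives all three
dimension statements; the cells of dimension `n` have entirely degenerate boundary, which makes them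
components.

Connectivity follows by general position: a map from a cube of smaller dimension can be made to miss
the centre of a cell and be pushed radially off it, starting with the last cell attached. -/

/-! ### Connectivity of relative cell complexes -/

open Set Metric Filter in
/-- A map into the union of a closed set `Y` and an open cell attached to it can be pushed into `Y`
along the segments that join the values `u = ψ (f x)` in the open ball to points `s x` of the
sphere, as long as `s x` is close to `u` near the sphere. -/
theorem exists_homotopicRel_of_cell {K X : Type*} [TopologicalSpace K] [TopologicalSpace X]
    [T2Space X] {m : ℕ} {Φ : (Fin m → ℝ) → X} {ψ : X → Fin m → ℝ} {Y : Set X}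
    (hΦ : ContinuousOn Φ (closedBall 0 1)) (hψ : ContinuousOn ψ (Φ '' ball 0 1))
    (hinv : ∀ z ∈ ball (0 : Fin m → ℝ) 1, ψ (Φ z) = z) (hY : IsClosed Y)
    (hdisj : Disjoint (Φ '' ball 0 1) Y) (hsph : MapsTo Φ (sphere 0 1) Y)
    (f : C(K, X)) (hf : ∀ x, f x ∈ Y ∪ Φ '' ball 0 1) (s : K → Fin m → ℝ) (c : ℝ)
    (hs : ContinuousOn s {x | f x ∉ Y}) (hs1 : ∀ x, f x ∉ Y → ‖s x‖ = 1)
    (hsc : ∀ x, f x ∉ Y → ‖s x - ψ (f x)‖ ≤ c * (1 - ‖ψ (f x)‖)) :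
    ∃ g : C(K, X), (∀ x, g x ∈ Y) ∧ f.HomotopicRel g {x | f x ∈ Y} := by
  classical
  have hu : ∀ x, f x ∉ Y → ψ (f x) ∈ ball (0 : Fin m → ℝ) 1 ∧ Φ (ψ (f x)) = f x := by
    intro x hx
    obtain ⟨z, hz, hzx⟩ := (hf x).resolve_left hx
    rw [← hzx, hinv z hz]
    exact ⟨hz, rfl⟩
  set R : unitInterval × K → Fin m → ℝ :=
    fun p => (1 - p.1 : ℝ) • ψ (f p.2) + (p.1 : ℝ) • s p.2 with hR
  have hRmem : ∀ p : unitInterval × K, f p.2 ∉ Y → R p ∈ closedBall (0 : Fin m → ℝ) 1 := by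
    intro p hp
    refine convex_closedBall (0 : Fin m → ℝ) 1 (ball_subset_closedBall (hu p.2 hp).1) ?_ ?_ ?_ ?_
    · simp [hs1 p.2 hp]
    · exact sub_nonneg.2 p.1.2.2
    · exact p.1.2.1
    · ring
  have hopen : IsOpen {p : unitInterval × K | f p.2 ∉ Y} :=
    (hY.preimage (f.continuous.comp continuous_snd)).isOpen_compl
  have hψf : ContinuousOn (fun x => ψ (f x)) {x | f x ∉ Y} :=
    hψ.comp f.continuous.continuousOn fun x hx => (hf x).resolve_left hx
  have hRc : ContinuousOn R {p | f p.2 ∉ Y} := by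
    have h1 : ContinuousOn (fun p : unitInterval × K => ψ (f p.2)) {p | f p.2 ∉ Y} :=
      hψf.comp continuous_snd.continuousOn fun p hp => hp
    have h2 : ContinuousOn (fun p : unitInterval × K => s p.2) {p | f p.2 ∉ Y} :=
      hs.comp continuous_snd.continuousOn fun p hp => hp
    exact ((by fun_prop : Continuous fun p : unitInterval × K =>
      (1 - p.1 : ℝ)).continuousOn.smul h1).add ((by fun_prop : Continuous
        fun p : unitInterval × K => (p.1 : ℝ)).continuousOn.smul h2)
  set H : unitInterval × K → X := fun p => if f p.2 ∈ Y then f p.2 else Φ (R p) with hH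
  have hHc : Continuous H := by
    rw [continuous_iff_continuousAt]
    intro p₀
    by_cases hp₀ : f p₀.2 ∈ Y
    · rw [ContinuousAt, tendsto_iff_ultrafilter]
      intro F hF
      have hfF : Tendsto (fun p : unitInterval × K => f p.2) F (𝓝 (f p₀.2)) :=
        ((f.continuous.comp continuous_snd).tendsto p₀).mono_left hF
      have hH0 : H p₀ = f p₀.2 := if_pos hp₀
      rw [hH0]
      by_cases hFY : {p : unitInterval × K | f p.2 ∈ Y} ∈ F
      · exact hfF.congr' (by filter_upwards [hFY] with p hp using (if_pos hp).symm)
      replace hFY : ∀ᶠ p in (F : Filter (unitInterval × K)), f p.2 ∉ Y :=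
        Ultrafilter.compl_mem_iff_notMem.2 hFY
      have hball : ∀ᶠ p in (F : Filter (unitInterval × K)),
          ψ (f p.2) ∈ closedBall (0 : Fin m → ℝ) 1 := by
        filter_upwards [hFY] with p hp using ball_subset_closedBall (hu p.2 hp).1
      obtain ⟨z, hz, hFz⟩ := (isCompact_closedBall (0 : Fin m → ℝ) 1).ultrafilter_le_nhds
        (F.map fun p => ψ (f p.2)) (by
          rw [Ultrafilter.coe_map, Filter.le_principal_iff]; exact hball)
      have hFz' : Tendsto (fun p : unitInterval × K => ψ (f p.2)) F (𝓝 z) := hFz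
      have hΦz : Φ z = f p₀.2 := by
        refine tendsto_nhds_unique (f := fun p : unitInterval × K => Φ (ψ (f p.2)))
          (l := (F : Filter (unitInterval × K))) ?_ (hfF.congr' ?_)
        · exact (hΦ z hz).tendsto.comp (tendsto_nhdsWithin_iff.2 ⟨hFz', hball⟩)
        · filter_upwards [hFY] with p hp using (hu p.2 hp).2.symm
      have hz1 : ‖z‖ = 1 := by
        refine le_antisymm (by simpa using hz) (not_lt.1 fun h => ?_)
        exact Set.disjoint_left.1 hdisj ⟨z, by simpa using h, hΦz⟩ hp₀
      -- As `‖z‖ = 1`, the bound `c * (1 - ‖ψ (f p.2)‖)` on the displacement tends to zero, so the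
      -- whole segment collapses to `z`.
      have hdiff : Tendsto (fun p => R p - ψ (f p.2)) F (𝓝 0) := by
        refine squeeze_zero_norm' (a := fun p => |c| * (1 - ‖ψ (f p.2)‖)) ?_ ?_
        · filter_upwards [hFY] with p hp
          have h1 := hsc p.2 hp
          have h2 := mem_ball_zero_iff.1 (hu p.2 hp).1
          have h3 : R p - ψ (f p.2) = (p.1 : ℝ) • (s p.2 - ψ (f p.2)) := by
            simp only [hR]; module
          rw [h3, norm_smul, Real.norm_of_nonneg p.1.2.1]
          calc (p.1 : ℝ) * ‖s p.2 - ψ (f p.2)‖ ≤ 1 * ‖s p.2 - ψ (f p.2)‖ := by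
                gcongr; exact p.1.2.2
            _ ≤ c * (1 - ‖ψ (f p.2)‖) := by rw [one_mul]; exact h1
            _ ≤ _ := by
                exact mul_le_mul_of_nonneg_right (le_abs_self c) (by linarith)
        · have := ((tendsto_const_nhds (x := (1 : ℝ))).sub hFz'.norm).const_mul |c|
          simpa [hz1] using this
      have hRz : Tendsto R F (𝓝 z) := by simpa using hdiff.add hFz'
      rw [← hΦz]
      refine ((hΦ z hz).tendsto.comp (tendsto_nhdsWithin_iff.2 ⟨hRz, ?_⟩)).congr' ?_
      · filter_upwards [hFY] with p hp using hRmem p hp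
      · filter_upwards [hFY] with p hp using (if_neg hp).symm
    · have h1 : ContinuousOn (fun p => Φ (R p)) {p | f p.2 ∉ Y} :=
        hΦ.comp hRc fun p hp => hRmem p hp
      refine (h1.continuousAt (hopen.mem_nhds hp₀)).congr ?_
      filter_upwards [hopen.mem_nhds hp₀] with p hp using (if_neg hp).symm
  refine ⟨⟨fun x => H (1, x), by fun_prop⟩, fun x => ?_, ⟨⟨⟨⟨H, hHc⟩, fun x => ?_, fun x => rfl⟩, ?_⟩⟩⟩
  · by_cases hx : f x ∈ Y
    · simp [hH, hx]
    · simp only [hH, ContinuousMap.coe_mk, if_neg hx]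
      apply hsph
      simp [hR, hs1 x hx]
  · by_cases hx : f x ∈ Y
    · simp [hH, hx]
    · simp [hH, hx, hR, (hu x hx).2]
  · intro t x hx
    exact if_pos hx

open Set Metric in
/-- A continuous map from an open subset of a compact subset of a space of smaller dimension to a
ball can be modified, away from the boundary of the ball, so as to miss the centre; composing with
the radial projection gives a map to the sphere. -/
theorem exists_continuousOn_norm_eq_one {E F : Type*} [NormedAddCommGroup E] [NormedSpace ℝ E]
    [FiniteDimensional ℝ E] [NormedAddCommGroup F] [NormedSpace ℝ F] [FiniteDimensional ℝ F]
    (hEF : Module.finrank ℝ E < Module.finrank ℝ F) {K : Set E} (hK : IsClosed K) {A : Set K}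
    {u : K → F} (hu : ContinuousOn u A) (hu1 : ∀ x ∈ A, ‖u x‖ < 1)
    (hC : IsClosed {x ∈ A | ‖u x‖ ≤ 1 / 2}) :
    ∃ (s : K → F) (c : ℝ), ContinuousOn s A ∧ (∀ x ∈ A, ‖s x‖ = 1) ∧
      ∀ x ∈ A, ‖s x - u x‖ ≤ c * (1 - ‖u x‖) := by
  set C : Set K := {x ∈ A | ‖u x‖ ≤ 1 / 2} with hCdef
  have he : IsClosedEmbedding (fun x : C => (x : K).1) :=
    hK.isClosedEmbedding_subtypeVal.comp hC.isClosedEmbedding_subtypeVal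
  obtain ⟨g, hg⟩ : ∃ g : C(E, F), ∀ x : C, g (x : K).1 = u x := by
    have : TietzeExtension F := by
      exact TietzeExtension.of_tvs ℝ
    obtain ⟨g, hg⟩ := ContinuousMap.exists_extension he
      (⟨fun x => u x, (hu.mono fun x hx => hx.1).domRestrict⟩ : C(C, F))
    exact ⟨g, fun x => DFunLike.congr_fun hg x⟩
  -- A `C^1` map from a space of smaller dimension has an image with dense complement, so it misses
  -- some small `p`. The two errors of `1 / 8` keep `v - p` within `1 / 4` of `u` on `C`.
  obtain ⟨v, hv, hvg, -⟩ := g.continuous.exists_contDiff_approx 1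
    (ε := fun _ => 1 / 8) continuous_const (fun _ => by norm_num)
  obtain ⟨p, hp, hpv⟩ := (hv.dense_compl_range_of_finrank_lt_finrank hEF).exists_mem_open
    (isOpen_ball (x := (0 : F)) (ε := 1 / 8)) ⟨0, by simp⟩
  rw [mem_ball_zero_iff] at hpv
  -- A cutoff, equal to 1 for `‖y‖ ≤ 1 / 4` and to 0 for `‖y‖ ≥ 1 / 2`.
  set l : F → ℝ := fun y => max 0 (min 1 (2 - 4 * ‖y‖)) with hl
  have hl0 : ∀ y, 0 ≤ l y := fun y => le_max_left _ _
  have hl1 : ∀ y, l y ≤ 1 := fun y => max_le zero_le_one (min_le_left _ _)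
  have hlc : Continuous l := by fun_prop
  set w : K → F := fun x => u x + l (u x) • (v x - p - u x) with hw
  have hwc : ContinuousOn w A := by
    refine hu.add ((hlc.comp_continuousOn hu).smul ?_)
    exact ((hv.continuous.comp continuous_subtype_val).continuousOn.sub
      continuousOn_const).sub hu
  have hlsmall : ∀ x ∈ A, ‖l (u x) • (v x - p - u x)‖ ≤ l (u x) / 4 ∧
      (l (u x) ≠ 0 → ‖v x - p - u x‖ < 1 / 4) := by
    intro x hx
    have key : l (u x) ≠ 0 → ‖v x - p - u x‖ < 1 / 4 := by
      intro h
      have hxC : ‖u x‖ ≤ 1 / 2 := by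
        by_contra hc
        apply h
        have : 2 - 4 * ‖u x‖ ≤ 0 := by linarith
        exact max_eq_left ((min_le_right _ _).trans this)
      have h1 := hvg x
      rw [show g x = u x from hg ⟨x, hx, hxC⟩, dist_eq_norm] at h1
      calc ‖v x - p - u x‖ = ‖(v x - u x) - p‖ := by congr 1; abel
        _ ≤ ‖v x - u x‖ + ‖p‖ := norm_sub_le _ _
        _ < 1 / 4 := by linarith
    refine ⟨?_, key⟩
    rw [norm_smul, Real.norm_of_nonneg (hl0 _)]
    by_cases h : l (u x) = 0
    · simp [h]
    · have := key h
      nlinarith [hl0 (u x)]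
  -- For `‖u x‖ ≤ 1 / 4` the value is `v x - p`, nonzero by the choice of `p`; elsewhere the
  -- correction has norm at most `1 / 4`, too small to cancel `u x`.
  have hw0 : ∀ x ∈ A, w x ≠ 0 := by
    intro x hx h0
    by_cases h : ‖u x‖ ≤ 1 / 4
    · have hl1 : l (u x) = 1 := by
        simp only [hl]
        rw [min_eq_left (by linarith)]
        norm_num
      apply hp
      refine ⟨x, ?_⟩
      have : w x = v x - p := by simp [hw, hl1]
      rw [h0] at this
      exact sub_eq_zero.1 this.symm
    · have h1 := (hlsmall x hx).1
      have h2 := hl1 (u x)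
      have h3 : u x = -(l (u x) • (v x - p - u x)) := eq_neg_of_add_eq_zero_left h0
      have h4 := congrArg norm h3
      rw [norm_neg] at h4
      linarith
  have hlK : ∀ x ∈ A, l (u x) ≤ 2 * (1 - ‖u x‖) := by
    intro x hx
    have := hu1 x hx
    refine max_le (by linarith) ?_
    by_cases h : ‖u x‖ ≤ 1 / 2
    · exact (min_le_left _ _).trans (by linarith)
    · exact (min_le_right _ _).trans (by linarith)
  -- The constant is `1 / 2 + 3 / 2`: the correction moves `u` by at most `(1 - ‖u‖) / 2`, and the
  -- radial projection moves `w` by `|1 - ‖w‖|`.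
  refine ⟨fun x => ‖w x‖⁻¹ • w x, 2, ?_, ?_, ?_⟩
  · exact (hwc.norm.inv₀ fun x hx => norm_ne_zero_iff.2 (hw0 x hx)).smul hwc
  · intro x hx
    rw [norm_smul, norm_inv, norm_norm, inv_mul_cancel₀ (norm_ne_zero_iff.2 (hw0 x hx))]
  · intro x hx
    have hne := norm_ne_zero_iff.2 (hw0 x hx)
    have h1 : ‖w x - u x‖ ≤ (1 - ‖u x‖) / 2 := by
      have := (hlsmall x hx).1
      have h2 := hlK x hx
      simp only [hw, add_sub_cancel_left]
      linarith
    have h2 : ‖‖w x‖⁻¹ • w x - w x‖ = |1 - ‖w x‖| := by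
      have : ‖w x‖⁻¹ • w x - w x = (‖w x‖⁻¹ - 1) • w x := by module
      rw [this, norm_smul, Real.norm_eq_abs, ← abs_norm (w x), ← abs_mul, abs_norm, sub_mul,
        inv_mul_cancel₀ hne, one_mul]
    have h3 : |1 - ‖w x‖| ≤ (1 - ‖u x‖) + (1 - ‖u x‖) / 2 := by
      have h4 := abs_norm_sub_norm_le (w x) (u x)
      have h5 := hu1 x hx
      rw [abs_le] at h4 ⊢
      constructor <;> linarith
    calc ‖‖w x‖⁻¹ • w x - u x‖ ≤ ‖‖w x‖⁻¹ • w x - w x‖ + ‖w x - u x‖ :=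
          norm_sub_le_norm_sub_add_norm_sub _ _ _
      _ ≤ 2 * (1 - ‖u x‖) := by rw [h2]; linarith

namespace FiniteRelCellComplex

open Set Metric

variable {X : Type*} [TopologicalSpace X] {D : Set X} (E : FiniteRelCellComplex D)

/-- The union of the base and the first `k` closed cells. -/
def stage (k : ℕ) : Set X := D ∪ ⋃ j : Fin E.numCells, ⋃ (_ : (j : ℕ) < k), E.map j '' closedBall 0 1

theorem stage_zero : E.stage 0 = D := by simp [stage]

theorem stage_mono {k l : ℕ} (h : k ≤ l) : E.stage k ⊆ E.stage l :=
  union_subset_union_right _ <| iUnion_mono fun _ => iUnion_mono' fun hj => ⟨hj.trans_le h, subset_rfl⟩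

theorem stage_numCells : E.stage E.numCells = univ := by
  rw [← E.union]
  simp [stage]

theorem isClosed_stage [T2Space X] (k : ℕ) : IsClosed (E.stage k) := by
  refine E.isClosed_base.union (isClosed_iUnion_of_finite fun j => isClosed_iUnion_of_finite fun _ => ?_)
  exact ((isCompact_closedBall _ _).image_of_continuousOn (E.continuousOn j)).isClosed

theorem mapsTo_stage (i : Fin E.numCells) : MapsTo (E.map i) (sphere 0 1) (E.stage i) :=
  E.mapsTo i

theorem image_closedBall_subset_stage {k : ℕ} {j : Fin E.numCells} (hj : (j : ℕ) < k) :
    E.map j '' closedBall 0 1 ⊆ E.stage k :=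
  fun _ hx => Or.inr (mem_iUnion₂.2 ⟨j, hj, hx⟩)

theorem stage_succ (i : Fin E.numCells) : E.stage (i + 1) = E.stage i ∪ E.openCell i := by
  apply subset_antisymm
  · refine union_subset (subset_union_left.trans subset_union_left) (iUnion₂_subset fun j hj => ?_)
    rcases Nat.lt_succ_iff_lt_or_eq.1 hj with h | h
    · exact (E.image_closedBall_subset_stage h).trans subset_union_left
    · obtain rfl : j = i := Fin.ext h
      rw [← ball_union_sphere, image_union]
      exact union_subset subset_union_right ((E.mapsTo_stage j).image_subset.trans subset_union_left)
  · refine union_subset (E.stage_mono (Nat.le_succ _)) ?_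
    exact (image_mono ball_subset_closedBall).trans
      (E.image_closedBall_subset_stage (Nat.lt_succ_self i))

theorem disjoint_openCell_stage (i : Fin E.numCells) {k : ℕ} (hk : k ≤ i) :
    Disjoint (E.openCell i) (E.stage k) := by
  induction k with
  | zero => rw [stage_zero]; exact E.disjoint_base i
  | succ k ih =>
    have hkn : k < E.numCells := by omega
    rw [E.stage_succ ⟨k, hkn⟩]
    refine (ih (by omega)).union_right (E.pairwise_disjoint _ _ fun h => ?_)
    rw [h] at hk
    exact absurd hk (by simp)

/-- A finite relative cell complex with cells of dimension more than `k` only is a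
`k`-connected pair. -/
theorem isConnectedPair [T2Space X] {k : ℤ} (hk : ∀ i, k < E.dim i) : IsConnectedPair D k := by
  intro d hd f hf
  suffices H : ∀ r ≤ E.numCells, ∀ f : C(closedBall (0 : Fin d → ℝ) 1, X),
      (∀ x, ‖x.1‖ = 1 → f x ∈ D) → (∀ x, f x ∈ E.stage r) →
      ∃ g : C(closedBall (0 : Fin d → ℝ) 1, X), (∀ x, g x ∈ D) ∧ f.HomotopicRel g {x | ‖x.1‖ = 1} from
    H E.numCells le_rfl f hf fun x => by rw [stage_numCells]; trivial
  intro r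
  induction r with
  | zero =>
    intro _ f _ h
    exact ⟨f, fun x => E.stage_zero ▸ h x, .refl f⟩
  | succ r ih =>
    intro hr f hf h
    let i : Fin E.numCells := ⟨r, hr⟩
    have hinv : ∀ z ∈ ball (0 : Fin (E.dim i) → ℝ) 1, (E.map i).symm (E.map i z) = z := fun z hz =>
      (E.map i).left_inv (by rwa [E.source_eq])
    have hψ : ContinuousOn (E.map i).symm (E.map i '' ball 0 1) := by
      rw [← E.source_eq, (E.map i).image_source_eq_target]
      exact E.continuousOn_symm i
    have hf' : ∀ x, f x ∈ E.stage r ∪ E.map i '' ball 0 1 := fun x => by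
      have := h x
      rwa [show r + 1 = (i : ℕ) + 1 from rfl, E.stage_succ i] at this
    have hdisj := E.disjoint_openCell_stage i le_rfl
    have hu : ∀ x, f x ∉ E.stage r → (E.map i).symm (f x) ∈ ball (0 : Fin (E.dim i) → ℝ) 1 ∧
        E.map i ((E.map i).symm (f x)) = f x := by
      intro x hx
      obtain ⟨z, hz, hzx⟩ := (hf' x).resolve_left hx
      rw [← hzx, hinv z hz]
      exact ⟨hz, rfl⟩
    have hC : IsClosed {x ∈ {x | f x ∉ E.stage r} | ‖(E.map i).symm (f x)‖ ≤ 1 / 2} := by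
      have hB : IsClosed (E.map i '' closedBall 0 (1 / 2)) :=
        ((isCompact_closedBall _ _).image_of_continuousOn ((E.continuousOn i).mono
          (closedBall_subset_closedBall (by norm_num)))).isClosed
      convert hB.preimage f.continuous using 1
      ext x
      constructor
      · rintro ⟨h1, h2⟩
        exact ⟨_, by simpa using h2, (hu x h1).2⟩
      · rintro ⟨z, hz, hzx⟩
        have hz' : z ∈ ball (0 : Fin (E.dim i) → ℝ) 1 :=
          closedBall_subset_ball (by norm_num) hz
        refine ⟨fun hx => disjoint_left.1 hdisj ⟨z, hz', hzx⟩ hx, ?_⟩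
        rw [← hzx, hinv z hz']
        simpa using hz
    have hdim : Module.finrank ℝ (Fin d → ℝ) < Module.finrank ℝ (Fin (E.dim i) → ℝ) := by
      have := hk i
      simp only [Module.finrank_fin_fun]
      omega
    obtain ⟨s, c, hs, hs1, hsc⟩ := exists_continuousOn_norm_eq_one hdim isClosed_closedBall
      (A := {x | f x ∉ E.stage r}) (u := fun x => (E.map i).symm (f x))
      (hψ.comp f.continuous.continuousOn fun x hx => (hf' x).resolve_left hx)
      (fun x hx => by simpa using (hu x hx).1) hC
    obtain ⟨g, hg, hfg⟩ := exists_homotopicRel_of_cell (E.continuousOn i) hψ hinv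
      (E.isClosed_stage r) hdisj (E.mapsTo_stage i) f hf' s c hs hs1 hsc
    have hsub : {x : closedBall (0 : Fin d → ℝ) 1 | ‖x.1‖ = 1} ⊆ {x | f x ∈ E.stage r} :=
      fun x hx => subset_union_left (hf x hx)
    -- The push fixes everything already in the earlier stage, in particular the boundary of the
    -- cube, which lies over `D`.
    have hfg' : f.HomotopicRel g {x | ‖x.1‖ = 1} :=
      hfg.map fun G => ⟨G.toHomotopy, fun t x hx => G.prop' t x (hsub hx)⟩
    obtain ⟨g', hg', hgg'⟩ := ih (by omega) g
      (fun x hx => by rw [← hfg'.fst_eq_snd hx]; exact hf x hx) hg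
    exact ⟨g', hg', hfg'.trans hgg'⟩

end FiniteRelCellComplex

/-! ### Attaching orders, convex cells and connected components -/

open Set Metric in
/-- A finite family of cells, attached in an order that refines a rank function. -/
theorem FiniteRelCellComplex.exists_of_rank {X ι R : Type*} [TopologicalSpace X] [Finite ι]
    [LinearOrder R] [T2Space X] {D : Set X} (hD : IsClosed D) (rank : ι → R) (dim : ι → ℕ)
    (map : ∀ i, PartialEquiv (Fin (dim i) → ℝ) X) (source_eq : ∀ i, (map i).source = ball 0 1)
    (continuousOn : ∀ i, ContinuousOn (map i) (closedBall 0 1))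
    (continuousOn_symm : ∀ i, ContinuousOn (map i).symm (map i).target)
    (pairwise_disjoint : ∀ i j, i ≠ j → Disjoint (map i '' ball 0 1) (map j '' ball 0 1))
    (disjoint_base : ∀ i, Disjoint (map i '' ball 0 1) D)
    (mapsTo : ∀ i, MapsTo (map i) (sphere 0 1)
      (D ∪ ⋃ j, ⋃ (_ : rank j < rank i), map j '' closedBall 0 1))
    (union : D ∪ ⋃ i, map i '' closedBall 0 1 = univ) :
    ∃ (E : FiniteRelCellComplex D) (e : Fin E.numCells ≃ ι),
      ∀ i, E.dim i = dim (e i) ∧ E.openCell i = map (e i) '' ball 0 1 := by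
  obtain ⟨n, ⟨e₀⟩⟩ := Finite.exists_equiv_fin ι
  let e : Fin n ≃ ι := (Tuple.sort (rank ∘ e₀.symm)).trans e₀.symm
  have he : Monotone (rank ∘ e) := Tuple.monotone_sort (rank ∘ e₀.symm)
  refine ⟨{
    numCells := n
    dim := fun i => dim (e i)
    map := fun i => map (e i)
    source_eq := fun i => source_eq _
    continuousOn := fun i => continuousOn _
    continuousOn_symm := fun i => continuousOn_symm _
    pairwise_disjoint := fun i j h => pairwise_disjoint _ _ (e.injective.ne h)
    disjoint_base := fun i => disjoint_base _
    mapsTo := fun i z hz => ?_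
    isClosed_base := hD
    closed := fun A hA hAD => ?_
    union := ?_ }, e, fun i => ⟨rfl, rfl⟩⟩
  · refine (mapsTo (e i) hz).imp id fun h => ?_
    obtain ⟨j, hj, hjz⟩ := mem_iUnion₂.1 h
    obtain ⟨j, rfl⟩ := e.surjective j
    exact mem_iUnion₂.2 ⟨j, lt_of_not_ge fun h => hj.not_ge (he h), hjz⟩
  · have : A = (A ∩ D) ∪ ⋃ i : Fin n, A ∩ map (e i) '' closedBall 0 1 := by
      rw [← inter_iUnion, ← inter_union_distrib_left, e.surjective.iUnion_comp
        (fun i => map i '' closedBall 0 1), union, inter_univ]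
    rw [this]
    exact hAD.union (isClosed_iUnion_of_finite hA)
  · rw [e.surjective.iUnion_comp (fun i => map i '' closedBall 0 1), union]

open Set Metric in
/-- A nonempty bounded open convex set in a finite-dimensional space is a cell. -/
theorem Convex.exists_homeomorph_unitBall {V : Type*} [NormedAddCommGroup V] [NormedSpace ℝ V]
    [FiniteDimensional ℝ V] {s : Set V} (hc : Convex ℝ s) (ho : IsOpen s) (hne : s.Nonempty)
    (hb : Bornology.IsBounded s) :
    ∃ h : (Fin (Module.finrank ℝ V) → ℝ) ≃ₜ V, h '' ball 0 1 = s ∧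
      h '' closedBall 0 1 = closure s ∧ h '' sphere 0 1 = frontier s := by
  let L : V ≃L[ℝ] (Fin (Module.finrank ℝ V) → ℝ) := ContinuousLinearEquiv.ofFinrankEq (by simp)
  have hoL : IsOpen (L '' s) := L.toHomeomorph.isOpenMap s ho
  obtain ⟨h, h1, h2, h3⟩ := exists_homeomorph_image_interior_closure_frontier_eq_unitBall
    (s := L '' s) (hc.linear_image L.toLinearMap) (by
      rw [hoL.interior_eq]; exact hne.image _)
    (L.lipschitz.isBounded_image hb)
  have hLc : L '' closure s = closure (L '' s) := L.toHomeomorph.image_closure s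
  have hLf : L '' frontier s = frontier (L '' s) := L.toHomeomorph.image_frontier s
  have key : ∀ t : Set V, (h.symm.trans L.symm.toHomeomorph) '' (h '' (L '' t)) = t := by
    intro t
    simp [image_image]
  refine ⟨h.symm.trans L.symm.toHomeomorph, ?_, ?_, ?_⟩
  · rw [← h1, hoL.interior_eq, key]
  · rw [← h2, ← hLc, key]
  · rw [← h3, ← hLf, key]

open Set in
/-- If a set is the disjoint union of finitely many nonempty connected sets, each closed in it,
then these are its connected components. -/
theorem componentsOf_iUnion {X ι : Type*} [TopologicalSpace X] [Finite ι] (P Z : ι → Set X)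
    (hne : ∀ i, (P i).Nonempty) (hP : ∀ i, IsPreconnected (P i))
    (hdisj : ∀ i j, i ≠ j → Disjoint (P i) (P j)) (hZ : ∀ i, IsClosed (Z i))
    (hPZ : ∀ i, P i = (⋃ j, P j) ∩ Z i) : componentsOf (⋃ i, P i) = range P := by
  have key : ∀ i, ∀ x ∈ P i, connectedComponentIn (⋃ j, P j) x = P i := by
    intro i x hx
    have hxS : x ∈ ⋃ j, P j := mem_iUnion.2 ⟨i, hx⟩
    apply subset_antisymm
    · intro y hy
      obtain ⟨j, hj⟩ := mem_iUnion.1 (connectedComponentIn_subset _ _ hy)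
      by_contra hyi
      have hji : j ≠ i := fun h => hyi (h ▸ hj)
      have hsub := connectedComponentIn_subset (⋃ j, P j) x
      -- The closed sets `Z i` and the union of the other `Z k` cover the component. If it also met
      -- some `P j`, connectedness would give a point in two of the disjoint pieces.
      obtain ⟨z, hz, hz1, hz2⟩ := isPreconnected_closed_iff.1
        (isPreconnected_connectedComponentIn (x := x) (F := ⋃ j, P j)) (Z i)
        (⋃ k, ⋃ (_ : k ≠ i), Z k) (hZ i)
        (isClosed_iUnion_of_finite fun k => isClosed_iUnion_of_finite fun _ => hZ k)
        (fun z hz => by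
          obtain ⟨k, hk⟩ := mem_iUnion.1 (hsub hz)
          have hkZ : z ∈ Z k := ((hPZ k).subset hk).2
          by_cases h : k = i
          · exact Or.inl (h ▸ hkZ)
          · exact Or.inr (mem_iUnion₂.2 ⟨k, h, hkZ⟩))
        ⟨x, mem_connectedComponentIn hxS, ((hPZ i).subset hx).2⟩
        ⟨y, hy, mem_iUnion₂.2 ⟨j, hji, ((hPZ j).subset hj).2⟩⟩
      obtain ⟨k, hk, hzk⟩ := mem_iUnion₂.1 hz2
      have h1 : z ∈ P i := (hPZ i).superset ⟨hsub hz, hz1⟩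
      have h2 : z ∈ P k := (hPZ k).superset ⟨hsub hz, hzk⟩
      exact disjoint_left.1 (hdisj k i hk) h2 h1
    · exact (hP i).subset_connectedComponentIn hx (subset_iUnion P i)
  ext C
  constructor
  · rintro ⟨x, hx, rfl⟩
    obtain ⟨i, hi⟩ := mem_iUnion.1 hx
    exact ⟨i, (key i x hi).symm⟩
  · rintro ⟨i, rfl⟩
    obtain ⟨x, hx⟩ := hne i
    exact ⟨x, mem_iUnion.2 ⟨i, hx⟩, (key i x hx).symm⟩

/-! ### Pointed cell decompositions and lexicographic order types -/

/-- The open unit ball of the coordinate subspace of the first `d` coordinates. -/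
def coordBall (M d : ℕ) : Set (Fin M → ℝ) := {y | (∀ k : Fin M, d ≤ k → y k = 0) ∧ ‖y‖ < 1}

/-- A decomposition of a pointed space `(X, pt)` into the point `pt` and open cells of positive
dimension. For uniformity all the characteristic maps are defined on the same space `ℝ ^ M`, and
only their restrictions to a coordinate subspace matter. -/
structure PointedCells (X : Type*) [TopologicalSpace X] (pt : X) (C : Type*) (M : ℕ) where
  dim : C → ℕ
  dim_pos : ∀ c, 0 < dim c
  dim_le : ∀ c, dim c ≤ M
  map : C → (Fin M → ℝ) → X
  inv : C → X → Fin M → ℝ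
  continuousOn_map : ∀ c, ContinuousOn (map c) (Metric.closedBall 0 1)
  continuousOn_inv : ∀ c, ContinuousOn (inv c) (map c '' coordBall M (dim c))
  inv_map : ∀ c, ∀ y ∈ coordBall M (dim c), inv c (map c y) = y
  map_ne : ∀ c, ∀ y ∈ coordBall M (dim c), map c y ≠ pt
  eq_of_map_eq : ∀ c c', ∀ y ∈ coordBall M (dim c), ∀ y' ∈ coordBall M (dim c'),
    map c y = map c' y' → c = c'
  exists_map_eq : ∀ p, p ≠ pt → ∃ c, ∃ y ∈ coordBall M (dim c), map c y = p
  map_boundary : ∀ c (y : Fin M → ℝ), (∀ k : Fin M, dim c ≤ k → y k = 0) → ‖y‖ = 1 →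
    map c y = pt ∨ ∃ c', dim c' < dim c ∧ ∃ y' ∈ coordBall M (dim c'), map c' y' = map c y

/-- The lexicographic order relations between those points of a configuration that lie in the same
cell, together with the number of leading coordinates in which they agree. -/
def orderType {N C : Type*} {M : ℕ} (j : N → C) (x : N → Fin M → ℝ) : Set (N × N × Fin M) :=
  {t | j t.1 = j t.2.1 ∧ (∀ l < t.2.2, x t.1 l = x t.2.1 l) ∧ x t.1 t.2.2 < x t.2.1 t.2.2}

theorem exists_mem_orderType {N C : Type*} {M : ℕ} {j : N → C} {x : N → Fin M → ℝ} {a b : N}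
    (hj : j a = j b) (hx : x a ≠ x b) :
    ∃ k, (a, b, k) ∈ orderType j x ∨ (b, a, k) ∈ orderType j x := by
  obtain ⟨k, hk, hmin⟩ := WellFounded.has_min (wellFounded_lt (α := Fin M)) {k | x a k ≠ x b k}
    (Function.ne_iff.1 hx)
  have hl : ∀ l < k, x a l = x b l := fun l hl => by
    by_contra h
    exact hmin l h hl
  refine ⟨k, (lt_or_gt_of_ne hk).imp (fun h => ⟨hj, hl, h⟩) fun h => ⟨hj.symm, ?_, h⟩⟩
  exact fun l h => (hl l h).symm

/-- The relation that an order type records for a pair of points is unique. -/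
theorem eq_of_mem_orderType {N C : Type*} {M : ℕ} {j : N → C} {x : N → Fin M → ℝ} {a b : N}
    {k : Fin M} (h : (a, b, k) ∈ orderType j x) :
    (∀ k', (a, b, k') ∈ orderType j x → k' = k) ∧ ∀ k', (b, a, k') ∉ orderType j x := by
  obtain ⟨-, h2, h3⟩ := h
  dsimp only at h2 h3
  refine ⟨fun k' ⟨_, h2', h3'⟩ => ?_, fun k' ⟨_, h2', h3'⟩ => ?_⟩ <;> dsimp only at h2' h3' <;>
    rcases lt_trichotomy k' k with h | h | h
  · exact absurd (h2 _ h) h3'.ne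
  · exact h
  · exact absurd (h2' _ h) h3.ne
  · exact absurd (h2 _ h) h3'.ne'
  · subst h
    exact lt_asymm h3 h3'
  · exact absurd (h2' _ h) h3.ne'

/-! ### Configuration cells as convex polytopes -/

namespace PointedCells

open Set Metric Module

variable {X : Type*} [TopologicalSpace X] {pt : X} {C : Type*} {M : ℕ}
  (S : PointedCells X pt C M)

/-- Coordinates of injective configurations of points in the cells given by `j`. -/
def IsConfig {N : Type*} (j : N → C) (x : N → Fin M → ℝ) : Prop :=
  (∀ a, x a ∈ coordBall M (S.dim (j a))) ∧ ∀ a b, j a = j b → x a = x b → a = b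

/-- The types of configurations: the cells in which the points lie and their order type. -/
abbrev ConfigType (N : Type*) : Type _ :=
  {c : (N → C) × Set (N × N × Fin M) // ∃ x, S.IsConfig c.1 x ∧ orderType c.1 x = c.2}

/-- The set of configurations of a given type. -/
def configCell {N : Type*} (c : S.ConfigType N) : Set (N → X) :=
  {f | ∃ x, S.IsConfig c.1.1 x ∧ orderType c.1.1 x = c.1.2 ∧ f = fun a => S.map (c.1.1 a) (x a)}

/-- The linear equations satisfied by the coordinates of the configurations of a given type. -/
def configSpan {N : Type*} (c : S.ConfigType N) : Submodule ℝ (N → Fin M → ℝ) where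
  carrier := {x | (∀ a, ∀ k : Fin M, S.dim (c.1.1 a) ≤ k → x a k = 0) ∧
    ∀ t ∈ c.1.2, ∀ l < t.2.2, x t.1 l = x t.2.1 l}
  zero_mem' := by simp
  add_mem' := fun {x y} hx hy => ⟨fun a k hk => by simp [hx.1 a k hk, hy.1 a k hk],
    fun t ht l hl => by simp [hx.2 t ht l hl, hy.2 t ht l hl]⟩
  smul_mem' := fun r x hx => ⟨fun a k hk => by simp [hx.1 a k hk],
    fun t ht l hl => by simp [hx.2 t ht l hl]⟩

theorem mem_configSpan {N : Type*} {c : S.ConfigType N} {x : N → Fin M → ℝ} :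
    x ∈ S.configSpan c ↔ (∀ a, ∀ k : Fin M, S.dim (c.1.1 a) ≤ k → x a k = 0) ∧
      ∀ t ∈ c.1.2, ∀ l < t.2.2, x t.1 l = x t.2.1 l := Iff.rfl

theorem IsConfig.mem_configSpan {S : PointedCells X pt C M} {N : Type*} {c : S.ConfigType N}
    {x : N → Fin M → ℝ} (hx : S.IsConfig c.1.1 x) (hc : orderType c.1.1 x = c.1.2) :
    x ∈ S.configSpan c :=
  ⟨fun a => (hx.1 a).1, fun t ht => by rw [← hc] at ht; exact ht.2.1⟩

theorem eq_of_map_eq_map {c c' : C} {y y' : Fin M → ℝ} (hy : y ∈ coordBall M (S.dim c))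
    (hy' : y' ∈ coordBall M (S.dim c')) (h : S.map c y = S.map c' y') : c = c' ∧ y = y' := by
  obtain rfl := S.eq_of_map_eq _ _ _ hy _ hy' h
  exact ⟨rfl, by rw [← S.inv_map _ _ hy, h, S.inv_map _ _ hy']⟩

theorem disjoint_configCell {N : Type*} {c c' : S.ConfigType N} (h : c ≠ c') :
    Disjoint (S.configCell c) (S.configCell c') := by
  rw [Set.disjoint_left]
  rintro _ ⟨x, hx, hxc, rfl⟩ ⟨x', hx', hxc', he⟩
  have key := fun a => S.eq_of_map_eq_map (hx.1 a) (hx'.1 a) (congrFun he a)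
  have h1 : c.1.1 = c'.1.1 := funext fun a => (key a).1
  have h2 : x = x' := funext fun a => (key a).2
  apply h
  refine Subtype.ext (Prod.ext h1 ?_)
  rw [← hxc, ← hxc', h1, h2]

theorem configCell_nonempty {N : Type*} (c : S.ConfigType N) : (S.configCell c).Nonempty := by
  obtain ⟨x, hx, hc⟩ := c.2
  exact ⟨_, x, hx, hc, rfl⟩

theorem injective_of_mem_configCell {N : Type*} {c : S.ConfigType N} {f : N → X}
    (hf : f ∈ S.configCell c) : Function.Injective f := by
  obtain ⟨x, hx, -, rfl⟩ := hf
  intro a b hab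
  have := S.eq_of_map_eq_map (hx.1 a) (hx.1 b) hab
  exact hx.2 a b this.1 this.2

/-- The configurations that contain the base point or are not injective. -/
def degenerate (pt : X) (N : Type*) : Set (N → X) :=
  {f | (∃ a, f a = pt) ∨ ¬ Function.Injective f}

theorem disjoint_configCell_degenerate {N : Type*} (c : S.ConfigType N) :
    Disjoint (S.configCell c) (degenerate pt N) := by
  rw [Set.disjoint_left]
  rintro f hf (⟨a, ha⟩ | hinj)
  · obtain ⟨x, hx, -, rfl⟩ := hf
    exact S.map_ne _ _ (hx.1 a) ha
  · exact hinj (S.injective_of_mem_configCell hf)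

theorem exists_mem_configCell {N : Type*} {f : N → X} (hf : f ∉ degenerate pt N) :
    ∃ c, f ∈ S.configCell (N := N) c := by
  simp only [degenerate, mem_ofPred_eq, not_or, not_exists, not_not] at hf
  choose j x hx hjx using fun a => S.exists_map_eq (f a) (hf.1 a)
  have hconf : S.IsConfig j x :=
    ⟨hx, fun a b hab hxab => hf.2 (by rw [← hjx a, ← hjx b, hab, hxab])⟩
  exact ⟨⟨(j, orderType j x), x, hconf, rfl⟩, x, hconf, rfl, funext fun a => (hjx a).symm⟩

/-- A linear projection to the span of a given type. -/
noncomputable def configProj {N : Type*} (c : S.ConfigType N) : (N → Fin M → ℝ) →ₗ[ℝ] S.configSpan c :=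
  (LinearMap.exists_leftInverse_of_injective (S.configSpan c).subtype
    (Submodule.ker_subtype _)).choose

theorem configProj_apply {N : Type*} (c : S.ConfigType N) (x : S.configSpan c) :
    S.configProj c x.1 = x :=
  LinearMap.congr_fun (LinearMap.exists_leftInverse_of_injective (S.configSpan c).subtype
    (Submodule.ker_subtype _)).choose_spec x

theorem continuous_configSpan_apply {N : Type*} (c : S.ConfigType N) (a : N) :
    Continuous fun x : S.configSpan c => x.1 a :=
  (continuous_apply a).comp continuous_subtype_val

theorem continuous_configSpan_apply_apply {N : Type*} (c : S.ConfigType N) (a : N) (k : Fin M) :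
    Continuous fun x : S.configSpan c => x.1 a k :=
  (continuous_apply k).comp (S.continuous_configSpan_apply c a)

variable {N : Type*} [Fintype N]

/-- The coordinates of the configurations of a given type, as an open convex subset of the
subspace that they span. -/
def configPolytope (c : S.ConfigType N) : Set (S.configSpan c) :=
  {x | ‖x‖ < 1 ∧ ∀ t ∈ c.1.2, x.1 t.1 t.2.2 < x.1 t.2.1 t.2.2}

/-- The convex conditions only ask that the recorded relations hold. They exclude any further
relation because a realizable type already compares every two distinct points in a common cell, and
a pair admits only one relation. -/
theorem mem_configPolytope_iff (c : S.ConfigType N) (x : S.configSpan c) :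
    x ∈ S.configPolytope c ↔ S.IsConfig c.1.1 x.1 ∧ orderType c.1.1 x.1 = c.1.2 := by
  obtain ⟨x₀, hx₀, hτ⟩ := c.2
  constructor
  · rintro ⟨hn, hlt⟩
    have hsub : c.1.2 ⊆ orderType c.1.1 x.1 := fun t ht =>
      ⟨(hτ.superset ht).1, x.2.2 t ht, hlt t ht⟩
    have hex : ∀ a b, a ≠ b → c.1.1 a = c.1.1 b → ∃ k, (a, b, k) ∈ c.1.2 ∨ (b, a, k) ∈ c.1.2 :=
      fun a b hab hj => hτ ▸ exists_mem_orderType hj fun h => hab (hx₀.2 a b hj h)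
    refine ⟨⟨fun a => ⟨x.2.1 a, (norm_le_pi_norm x.1 a).trans_lt hn⟩, fun a b hj hab => ?_⟩,
      subset_antisymm ?_ hsub⟩
    · by_contra hne
      obtain ⟨k, hk | hk⟩ := hex a b hne hj
      · exact (hlt _ hk).ne (congrFun hab k)
      · exact (hlt _ hk).ne (congrFun hab k).symm
    · rintro ⟨a, b, k⟩ ht
      obtain ⟨k', hk | hk⟩ := hex a b (by rintro rfl; exact lt_irrefl _ ht.2.2) ht.1
      · rwa [← (eq_of_mem_orderType ht).1 k' (hsub hk)]
      · exact absurd (hsub hk) ((eq_of_mem_orderType ht).2 k')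
  · rintro ⟨hx, hc⟩
    refine ⟨(pi_norm_lt_iff one_pos).2 fun a => (hx.1 a).2, fun t ht => ?_⟩
    rw [← hc] at ht
    exact ht.2.2

theorem configPolytope_nonempty (c : S.ConfigType N) : (S.configPolytope c).Nonempty := by
  obtain ⟨x₀, hx₀, hτ⟩ := c.2
  exact ⟨⟨x₀, hx₀.mem_configSpan hτ⟩, (S.mem_configPolytope_iff c _).2 ⟨hx₀, hτ⟩⟩

theorem isOpen_configPolytope (c : S.ConfigType N) : IsOpen (S.configPolytope c) := by
  have : S.configPolytope c = {x | ‖x‖ < 1} ∩ ⋂ t ∈ c.1.2, {x | x.1 t.1 t.2.2 < x.1 t.2.1 t.2.2} := by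
    ext; simp [configPolytope]
  rw [this]
  refine (isOpen_lt continuous_norm continuous_const).inter
    ((toFinite c.1.2).isOpen_biInter fun t _ => isOpen_lt
      (S.continuous_configSpan_apply_apply c _ _) (S.continuous_configSpan_apply_apply c _ _))

theorem convex_configPolytope (c : S.ConfigType N) : Convex ℝ (S.configPolytope c) := by
  rw [convex_iff_forall_pos]
  intro x hx y hy a b ha hb hab
  refine ⟨?_, fun t ht => ?_⟩
  · simpa using convex_ball (0 : S.configSpan c) 1 (by simpa using hx.1) (by simpa using hy.1)
      ha.le hb.le hab
  · exact add_lt_add (mul_lt_mul_of_pos_left (hx.2 t ht) ha) (mul_lt_mul_of_pos_left (hy.2 t ht) hb)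

theorem closure_configPolytope_subset (c : S.ConfigType N) : closure (S.configPolytope c) ⊆
    {x | ‖x‖ ≤ 1 ∧ ∀ t ∈ c.1.2, x.1 t.1 t.2.2 ≤ x.1 t.2.1 t.2.2} := by
  refine closure_minimal (fun x hx => ⟨hx.1.le, fun t ht => (hx.2 t ht).le⟩) ?_
  have : {x : S.configSpan c | ‖x‖ ≤ 1 ∧ ∀ t ∈ c.1.2, x.1 t.1 t.2.2 ≤ x.1 t.2.1 t.2.2} =
      {x | ‖x‖ ≤ 1} ∩ ⋂ t ∈ c.1.2, {x | x.1 t.1 t.2.2 ≤ x.1 t.2.1 t.2.2} := by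
    ext; simp
  rw [this]
  refine (isClosed_le continuous_norm continuous_const).inter
    (isClosed_biInter fun t _ => isClosed_le
      (S.continuous_configSpan_apply_apply c _ _) (S.continuous_configSpan_apply_apply c _ _))

theorem exists_configChart (c : S.ConfigType N) :
    ∃ h : (Fin (finrank ℝ (S.configSpan c)) → ℝ) ≃ₜ S.configSpan c,
      h '' ball 0 1 = S.configPolytope c ∧ h '' closedBall 0 1 = closure (S.configPolytope c) ∧
        h '' sphere 0 1 = frontier (S.configPolytope c) :=
  (S.convex_configPolytope c).exists_homeomorph_unitBall (S.isOpen_configPolytope c)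
    (S.configPolytope_nonempty c)
    (isBounded_iff_forall_norm_le.2 ⟨1, fun _ hx => hx.1.le⟩)

/-- A parametrization of the polytope of a given type by the unit ball. -/
noncomputable def configChart (c : S.ConfigType N) :
    (Fin (finrank ℝ (S.configSpan c)) → ℝ) ≃ₜ S.configSpan c :=
  (S.exists_configChart c).choose

theorem isConfig_configChart {c : S.ConfigType N} {z : Fin (finrank ℝ (S.configSpan c)) → ℝ}
    (hz : z ∈ ball 0 1) : S.IsConfig c.1.1 (S.configChart c z).1 ∧
      orderType c.1.1 (S.configChart c z).1 = c.1.2 := by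
  rw [← mem_configPolytope_iff, ← (S.exists_configChart c).choose_spec.1]
  exact mem_image_of_mem _ hz

/-- The characteristic map of a cell of configurations. -/
noncomputable def configMap (c : S.ConfigType N) :
    PartialEquiv (Fin (finrank ℝ (S.configSpan c)) → ℝ) (N → X) where
  toFun z a := S.map (c.1.1 a) ((S.configChart c z).1 a)
  invFun f := (S.configChart c).symm (S.configProj c fun a => S.inv (c.1.1 a) (f a))
  source := ball 0 1
  target := (fun z a => S.map (c.1.1 a) ((S.configChart c z).1 a)) '' ball 0 1
  map_source' z hz := mem_image_of_mem _ hz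
  map_target' := by
    rintro _ ⟨z, hz, rfl⟩
    have := S.isConfig_configChart hz
    simpa [S.inv_map _ _ (this.1.1 _), configProj_apply] using hz
  left_inv' z hz := by
    have := S.isConfig_configChart hz
    simp [S.inv_map _ _ (this.1.1 _), configProj_apply]
  right_inv' := by
    rintro _ ⟨z, hz, rfl⟩
    have := S.isConfig_configChart hz
    simp [S.inv_map _ _ (this.1.1 _), configProj_apply]

theorem configMap_image_ball (c : S.ConfigType N) :
    S.configMap c '' ball 0 1 = S.configCell c := by
  apply subset_antisymm
  · rintro _ ⟨z, hz, rfl⟩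
    have := S.isConfig_configChart hz
    exact ⟨_, this.1, this.2, rfl⟩
  · rintro _ ⟨x, hx, hc, rfl⟩
    have h := (S.mem_configPolytope_iff c ⟨x, hx.mem_configSpan hc⟩).2 ⟨hx, hc⟩
    rw [← (S.exists_configChart c).choose_spec.1] at h
    obtain ⟨z, hz, hzx⟩ := h
    refine ⟨z, hz, funext fun a => ?_⟩
    have : (S.configChart c z).1 = x := congrArg Subtype.val hzx
    exact congrArg (fun y : N → Fin M → ℝ => S.map (c.1.1 a) (y a)) this

theorem configChart_mem_closure {c : S.ConfigType N} {z : Fin (finrank ℝ (S.configSpan c)) → ℝ}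
    (hz : z ∈ closedBall 0 1) : S.configChart c z ∈ closure (S.configPolytope c) := by
  rw [← (S.exists_configChart c).choose_spec.2.1]
  exact mem_image_of_mem _ hz

theorem continuousOn_configMap (c : S.ConfigType N) :
    ContinuousOn (S.configMap c) (closedBall 0 1) := by
  refine continuousOn_pi.2 fun a => (S.continuousOn_map (c.1.1 a)).comp
    (f := fun z => (S.configChart c z).1 a) (((S.continuous_configSpan_apply c a).comp
      (S.configChart c).continuous).continuousOn) fun z hz => ?_
  have := (S.closure_configPolytope_subset c (S.configChart_mem_closure hz)).1
  simpa using (norm_le_pi_norm (S.configChart c z).1 a).trans this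

theorem continuousOn_configMap_symm (c : S.ConfigType N) :
    ContinuousOn (S.configMap c).symm (S.configMap c).target := by
  refine (S.configChart c).symm.continuous.comp_continuousOn
    ((S.configProj c).continuous_of_finiteDimensional.comp_continuousOn
      (continuousOn_pi.2 fun a => (S.continuousOn_inv (c.1.1 a)).comp
        (continuous_apply a).continuousOn ?_))
  rintro _ ⟨z, hz, rfl⟩
  exact ⟨_, (S.isConfig_configChart hz).1.1 a, rfl⟩

/-! ### Boundaries and the attaching order -/

/-- Cells are attached in the order of increasing total dimension of the cells in which the points
lie, and for equal total dimensions in the order of increasing dimension. -/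
noncomputable def configRank (c : S.ConfigType N) : ℕ ×ₗ ℕ :=
  toLex (∑ a, S.dim (c.1.1 a), finrank ℝ (S.configSpan c))

/-- A boundary point of a cell of configurations is degenerate or lies in a cell of smaller rank. -/
theorem configMap_sphere {c : S.ConfigType N} {z : Fin (finrank ℝ (S.configSpan c)) → ℝ}
    (hz : z ∈ sphere 0 1) (hzD : S.configMap c z ∉ degenerate pt N) :
    ∃ c', S.configRank c' < S.configRank c ∧ S.configMap c z ∈ S.configCell c' := by
  obtain ⟨c', hc'⟩ := S.exists_mem_configCell hzD
  refine ⟨c', ?_, hc'⟩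
  set y := S.configChart c z with hy
  obtain ⟨hyn, hyle⟩ := S.closure_configPolytope_subset c
    (S.configChart_mem_closure (sphere_subset_closedBall hz))
  have hyP : y ∉ S.configPolytope c := by
    have : y ∈ frontier (S.configPolytope c) := by
      rw [← (S.exists_configChart c).choose_spec.2.2]
      exact mem_image_of_mem _ hz
    rw [(S.isOpen_configPolytope c).frontier_eq] at this
    exact this.2
  obtain ⟨x', hx', hτ', he⟩ := hc'
  have hea : ∀ a, S.map (c.1.1 a) (y.1 a) = S.map (c'.1.1 a) (x' a) := congrFun he
  -- A point whose coordinates have norm below 1 stays in its cell with the same coordinates. One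
  -- with norm 1 lands in a cell of smaller dimension, the base point being excluded by
  -- nondegeneracy.
  have key : ∀ a, S.dim (c'.1.1 a) < S.dim (c.1.1 a) ∨ c.1.1 a = c'.1.1 a ∧ y.1 a = x' a := by
    intro a
    rcases ((norm_le_pi_norm y.1 a).trans hyn).lt_or_eq with h | h
    · exact Or.inr (S.eq_of_map_eq_map ⟨y.2.1 a, h⟩ (hx'.1 a) (hea a))
    · left
      rcases S.map_boundary _ _ (y.2.1 a) h with h | ⟨d, hd, y', hy', hyy⟩
      · exact absurd (Or.inl ⟨a, h⟩) hzD
      · rw [hea a] at hyy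
        rwa [← S.eq_of_map_eq _ _ _ hy' _ (hx'.1 a) hyy]
  rw [configRank, configRank, Prod.Lex.toLex_lt_toLex]
  by_cases hall : ∃ a, S.dim (c'.1.1 a) < S.dim (c.1.1 a)
  · obtain ⟨a, ha⟩ := hall
    refine Or.inl (Finset.sum_lt_sum (fun b _ => ?_) ⟨a, Finset.mem_univ a, ha⟩)
    rcases key b with h | h
    · exact h.le
    · rw [h.1]
  · replace key := fun a => (key a).resolve_left (not_exists.1 hall a)
    have hj : c.1.1 = c'.1.1 := funext fun a => (key a).1
    have hyx : y.1 = x' := funext fun a => (key a).2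
    rw [← hyx] at hx' hτ'
    refine Or.inr ⟨by simp only [hj], Submodule.finrank_lt_finrank_of_lt ?_⟩
    -- All points have kept their cells. The equations of `c` persist at `y`, so two points compared
    -- at `k` first differ at some `k' ≥ k`, and later than `k` when their inequality has
    -- degenerated. Thus `c'` imposes all equations of `c`.
    have hagree : ∀ a b k, (a, b, k) ∈ c.1.2 → ∃ k', k ≤ k' ∧ (y.1 a k = y.1 b k → k < k') ∧
        ((a, b, k') ∈ c'.1.2 ∨ (b, a, k') ∈ c'.1.2) := by
      intro a b k ht
      obtain ⟨x₀, hx₀, hτ⟩ := c.2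
      rw [← hτ] at ht
      have hab : a ≠ b := by rintro rfl; exact lt_irrefl _ ht.2.2
      have hjab : c'.1.1 a = c'.1.1 b := hj ▸ ht.1
      obtain ⟨k', hk'⟩ := exists_mem_orderType hjab fun h => hab (hx'.2 a b hjab h)
      have hne : y.1 a k' ≠ y.1 b k' := by
        rcases hk' with h | h
        · exact h.2.2.ne
        · exact h.2.2.ne'
      rw [hτ] at ht
      have hle : k ≤ k' := le_of_not_gt fun h => hne (y.2.2 _ ht k' h)
      refine ⟨k', hle, fun h => hle.lt_of_ne ?_, hτ' ▸ hk'⟩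
      rintro rfl
      exact hne h
    have hmem : ∀ v ∈ S.configSpan c', ∀ a b k', ((a, b, k') ∈ c'.1.2 ∨ (b, a, k') ∈ c'.1.2) →
        ∀ l < k', v a l = v b l := by
      rintro v hv a b k' (h | h) l hl
      · exact hv.2 _ h l hl
      · exact (hv.2 _ h l hl).symm
    refine lt_of_le_of_ne (fun v hv => ⟨by rw [hj]; exact hv.1, ?_⟩) fun heq => ?_
    · rintro ⟨a, b, k⟩ ht l hl
      obtain ⟨k', hkk', -, h⟩ := hagree a b k ht
      exact hmem v hv a b k' h l (hl.trans_le hkk')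
    · have hyn1 : ‖y‖ < 1 := (pi_norm_lt_iff one_pos).2 fun a => (hx'.1 a).2
      -- Being on the frontier with norm below 1, `y` violates a strict inequality of `c`. The
      -- resulting new equation in coordinate `k` fails for the configuration `x₀` of type `c`, so
      -- the inclusion of spans is strict.
      obtain ⟨⟨a, b, k⟩, ht, hk⟩ : ∃ t ∈ c.1.2, ¬ y.1 t.1 t.2.2 < y.1 t.2.1 t.2.2 := by
        by_contra! h
        exact hyP ⟨hyn1, h⟩
      obtain ⟨k', -, hkk', h⟩ := hagree a b k ht
      obtain ⟨x₀, hx₀, hτ⟩ := c.2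
      have hx₀c := hx₀.mem_configSpan hτ
      rw [← heq] at hx₀c
      have h1 := hmem x₀ hx₀c a b k' h k (hkk' ((hyle _ ht).antisymm (not_lt.1 hk)))
      rw [← hτ] at ht
      exact ht.2.2.ne h1

theorem isClosed_degenerate [T2Space X] : IsClosed (degenerate pt N) := by
  have : degenerate pt N = (⋃ a, {f | f a = pt}) ∪
      ⋃ a, ⋃ b, ⋃ (_ : a ≠ b), {f : N → X | f a = f b} := by
    ext f
    simp only [degenerate, Function.Injective, mem_ofPred_eq, mem_union, mem_iUnion, not_forall]
    refine or_congr Iff.rfl (exists_congr fun a => exists_congr fun b => ?_)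
    constructor
    · rintro ⟨h, hne⟩
      exact ⟨hne, h⟩
    · rintro ⟨hne, h⟩
      exact ⟨h, hne⟩
  rw [this]
  refine (isClosed_iUnion_of_finite fun a => isClosed_eq (by fun_prop) (by fun_prop)).union
    (isClosed_iUnion_of_finite fun a => isClosed_iUnion_of_finite fun b =>
      isClosed_iUnion_of_finite fun _ => isClosed_eq (by fun_prop) (by fun_prop))

theorem exists_finiteRelCellComplex [T2Space X] [Finite C] :
    ∃ (E : FiniteRelCellComplex (degenerate pt N)) (e : Fin E.numCells ≃ S.ConfigType N),
      ∀ i, E.dim i = finrank ℝ (S.configSpan (e i)) ∧ E.openCell i = S.configCell (e i) := by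
  have hcover : ∀ f, f ∉ degenerate pt N → ∃ c, f ∈ S.configMap (N := N) c '' ball 0 1 := by
    intro f hf
    obtain ⟨c, hc⟩ := S.exists_mem_configCell hf
    exact ⟨c, by rwa [configMap_image_ball]⟩
  obtain ⟨E, e, h⟩ := FiniteRelCellComplex.exists_of_rank (isClosed_degenerate (pt := pt) (N := N))
    S.configRank (fun c => finrank ℝ (S.configSpan c)) S.configMap (fun _ => rfl)
    S.continuousOn_configMap S.continuousOn_configMap_symm
    (fun c c' h => by simpa only [configMap_image_ball] using S.disjoint_configCell h)
    (fun c => by simpa only [configMap_image_ball] using S.disjoint_configCell_degenerate c)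
    (fun c z hz => by
      by_cases hzD : S.configMap c z ∈ degenerate pt N
      · exact Or.inl hzD
      · obtain ⟨c', hr, hc'⟩ := S.configMap_sphere hz hzD
        rw [← configMap_image_ball] at hc'
        exact Or.inr (mem_iUnion₂.2 ⟨c', hr, image_mono ball_subset_closedBall hc'⟩))
    (eq_univ_of_forall fun f => by
      by_cases hf : f ∈ degenerate pt N
      · exact Or.inl hf
      · obtain ⟨c, hc⟩ := hcover f hf
        exact Or.inr (mem_iUnion.2 ⟨c, image_mono ball_subset_closedBall hc⟩))
  exact ⟨E, e, fun i => ⟨(h i).1, (h i).2.trans (S.configMap_image_ball _)⟩⟩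

end PointedCells

/-! ### Dimension count and the cells of dimension `n` -/

namespace PointedCells

open Set Metric Module

variable {X : Type*} [TopologicalSpace X] {pt : X} {C : Type*} {M : ℕ}
  (S : PointedCells X pt C M) {N : Type*} [Fintype N]

theorem card_add_dim_le_finrank (c : S.ConfigType N) (a₀ : N) :
    Fintype.card N + S.dim (c.1.1 a₀) ≤ finrank ℝ (S.configSpan c) + 1 := by
  classical
  set d := S.dim (c.1.1 a₀) with hd
  have hd0 : 0 < d := S.dim_pos _
  have hdM : d ≤ M := S.dim_le _
  -- The first factor moves the last coordinate of each point independently; the second gives all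
  -- points in the cell of `a₀` common leading coordinates. Injectivity yields dimension at least `n
  -- + (d - 1)`.
  let g : ((N → ℝ) × (Fin (d - 1) → ℝ)) →ₗ[ℝ] (N → Fin M → ℝ) :=
    { toFun := fun p a k => if (k : ℕ) + 1 = S.dim (c.1.1 a) then p.1 a else
        if h : c.1.1 a = c.1.1 a₀ ∧ (k : ℕ) < d - 1 then p.2 ⟨k, h.2⟩ else 0
      map_add' := fun p q => by
        ext a k
        simp only [Pi.add_apply, Prod.fst_add, Prod.snd_add]
        split_ifs <;> simp
      map_smul' := fun r p => by
        ext a k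
        simp only [Pi.smul_apply, Prod.smul_fst, Prod.smul_snd, RingHom.id_apply]
        split_ifs <;> simp }
  have hg : ∀ p a k, g p a k = if (k : ℕ) + 1 = S.dim (c.1.1 a) then p.1 a else
      if h : c.1.1 a = c.1.1 a₀ ∧ (k : ℕ) < d - 1 then p.2 ⟨k, h.2⟩ else 0 := fun _ _ _ => rfl
  have hmem : ∀ p, g p ∈ S.configSpan c := by
    obtain ⟨x₀, hx₀, hτ⟩ := c.2
    refine fun p => ⟨fun a k hk => ?_, ?_⟩
    · rw [hg, if_neg (by omega), dif_neg]
      rintro ⟨h1, h2⟩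
      rw [h1] at hk
      omega
    · rintro ⟨a, b, k⟩ ht l hl
      dsimp only at hl ⊢
      rw [← hτ] at ht
      have hj : c.1.1 a = c.1.1 b := ht.1
      -- Coordinates beyond the cell dimension vanish, so points differ at some `k` below it.
      -- Equations concern only `l < k` and never reach the last coordinate.
      have hk : (k : ℕ) < S.dim (c.1.1 a) := by
        by_contra hk
        rw [not_lt] at hk
        have h1 := (hx₀.1 a).1 k hk
        have h2 := (hx₀.1 b).1 k (hj ▸ hk)
        have h3 : x₀ a k < x₀ b k := ht.2.2
        rw [h1, h2] at h3
        exact lt_irrefl _ h3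
      have hlk : (l : ℕ) < k := hl
      rw [hg, hg, if_neg (by omega), if_neg (by rw [← hj]; omega)]
      simp only [hj]
  have hinj : Function.Injective (g.codRestrict (S.configSpan c) hmem) := by
    rw [injective_iff_map_eq_zero]
    intro p hp
    have hp' : ∀ a k, g p a k = 0 := fun a k =>
      congrFun (congrFun (congrArg Subtype.val hp) a) k
    refine Prod.ext (funext fun a => ?_) (funext fun i => ?_)
    · have h0 := S.dim_pos (c.1.1 a)
      have hM := S.dim_le (c.1.1 a)
      have := hp' a ⟨S.dim (c.1.1 a) - 1, by omega⟩
      rwa [hg, if_pos (by simp only; omega)] at this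
    · have := hp' a₀ ⟨i, by omega⟩
      rwa [hg, if_neg (by simp only; omega), dif_pos ⟨rfl, i.2⟩] at this
  have := LinearMap.finrank_le_finrank_of_injective hinj
  simp only [finrank_prod, finrank_fintype_fun_eq_card, Fintype.card_fin] at this
  omega

theorem card_le_finrank (c : S.ConfigType N) :
    Fintype.card N ≤ finrank ℝ (S.configSpan c) := by
  rcases isEmpty_or_nonempty N with h | ⟨⟨a⟩⟩
  · simp
  · have := S.card_add_dim_le_finrank c a
    have := S.dim_pos (c.1.1 a)
    omega

/-- The bound `n + d - 1` exceeds `n` unless `d = 1`; conversely, a point in a 1-cell has only one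
free coordinate. -/
theorem finrank_eq_card_iff (c : S.ConfigType N) :
    finrank ℝ (S.configSpan c) = Fintype.card N ↔ ∀ a, S.dim (c.1.1 a) = 1 := by
  constructor
  · intro h a
    have := S.card_add_dim_le_finrank c a
    have := S.dim_pos (c.1.1 a)
    omega
  · intro h
    refine le_antisymm ?_ (S.card_le_finrank c)
    have hM : ∀ _ : N, 0 < M := fun a => (S.dim_pos _).trans_le (S.dim_le (c.1.1 a))
    let g : S.configSpan c →ₗ[ℝ] (N → ℝ) :=
      { toFun := fun x a => x.1 a ⟨0, hM a⟩
        map_add' := fun _ _ => rfl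
        map_smul' := fun _ _ => rfl }
    have hg : Function.Injective g := by
      rw [injective_iff_map_eq_zero]
      intro x hx
      refine Subtype.ext (funext fun a => funext fun k => ?_)
      by_cases hk : (k : ℕ) = 0
      · rw [show k = ⟨0, hM a⟩ from Fin.ext hk]
        exact congrFun hx a
      · exact x.2.1 a k (by rw [h]; omega)
    simpa using LinearMap.finrank_le_finrank_of_injective hg

/-- Both entries of the rank equal their minimum `n` on such a cell, so no cell has smaller rank and
the whole boundary is degenerate. -/
theorem isClosed_configCell_union_degenerate [T2Space X] {c : S.ConfigType N}
    (hc : finrank ℝ (S.configSpan c) = Fintype.card N) :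
    IsClosed (S.configCell c ∪ degenerate pt N) := by
  have : S.configCell c ∪ degenerate pt N =
      S.configMap c '' closedBall 0 1 ∪ degenerate pt N := by
    rw [← ball_union_sphere, image_union, configMap_image_ball, union_assoc]
    congr 1
    refine (union_eq_right.2 ?_).symm
    rintro _ ⟨z, hz, rfl⟩
    by_contra hzD
    obtain ⟨c', hr, -⟩ := S.configMap_sphere hz hzD
    rw [configRank, configRank, Prod.Lex.toLex_lt_toLex] at hr
    have h1 : ∑ a, S.dim (c.1.1 a) ≤ ∑ a, S.dim (c'.1.1 a) :=
      Finset.sum_le_sum fun a _ => by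
        rw [(S.finrank_eq_card_iff c).1 hc a]; exact S.dim_pos _
    have h2 := S.card_le_finrank c'
    simp only at hr
    omega
  rw [this]
  exact ((isCompact_closedBall _ _).image_of_continuousOn
    (S.continuousOn_configMap c)).isClosed.union isClosed_degenerate

/-- The union of the open cells of dimension one. -/
def oneCells : Set X := ⋃ (c : C) (_ : S.dim c = 1), S.map c '' coordBall M 1

theorem iUnion_configCell_eq_conf :
    ⋃ c : {c : S.ConfigType N // finrank ℝ (S.configSpan c) = Fintype.card N}, S.configCell c.1 =
      Conf N S.oneCells := by
  ext f
  constructor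
  · intro hf
    obtain ⟨⟨c, hc⟩, hf⟩ := mem_iUnion.1 hf
    refine ⟨S.injective_of_mem_configCell hf, fun a => ?_⟩
    obtain ⟨x, hx, -, rfl⟩ := hf
    have h1 := (S.finrank_eq_card_iff c).1 hc a
    exact mem_iUnion₂.2 ⟨_, h1, x a, h1 ▸ hx.1 a, rfl⟩
  · rintro ⟨hinj, hf⟩
    have hf' : ∀ a, ∃ c, S.dim c = 1 ∧ ∃ y ∈ coordBall M (S.dim c), S.map c y = f a := by
      intro a
      obtain ⟨c, hc, y, hy, hya⟩ := mem_iUnion₂.1 (hf a)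
      exact ⟨c, hc, y, by rwa [hc], hya⟩
    choose j hj y hy hyf using hf'
    have hfD : f ∉ degenerate pt N := by
      rintro (⟨a, ha⟩ | h)
      · exact S.map_ne _ _ (hy a) ((hyf a).trans ha)
      · exact h hinj
    obtain ⟨c, hc⟩ := S.exists_mem_configCell hfD
    refine mem_iUnion.2 ⟨⟨c, (S.finrank_eq_card_iff c).2 fun a => ?_⟩, hc⟩
    obtain ⟨x, hx, -, rfl⟩ := hc
    rw [← (S.eq_of_map_eq_map (hy a) (hx.1 a) (hyf a)).1, hj]

theorem componentsOf_conf_oneCells [T2Space X] [Finite C] :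
    componentsOf (Conf N S.oneCells) =
      {K | ∃ c : S.ConfigType N, finrank ℝ (S.configSpan c) = Fintype.card N ∧
        S.configCell c = K} := by
  rw [← iUnion_configCell_eq_conf, componentsOf_iUnion
    (fun c : {c : S.ConfigType N // finrank ℝ (S.configSpan c) = Fintype.card N} =>
      S.configCell c.1) (fun c => S.configCell c.1 ∪ degenerate pt N)]
  · ext K
    simp
  · exact fun c => S.configCell_nonempty c.1
  · intro c
    rw [← configMap_image_ball]
    exact (convex_ball _ _).isPreconnected.image _
      ((S.continuousOn_configMap c.1).mono ball_subset_closedBall)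
  · exact fun c c' h => S.disjoint_configCell fun h' => h (Subtype.ext h')
  · exact fun c => S.isClosed_configCell_union_degenerate c.2
  · intro c
    apply subset_antisymm
    · exact fun f hf => ⟨mem_iUnion.2 ⟨c, hf⟩, Or.inl hf⟩
    · rintro f ⟨hf, hf' | hf'⟩
      · exact hf'
      · obtain ⟨c', hc'⟩ := mem_iUnion.1 hf
        exact absurd hf' (disjoint_left.1 (S.disjoint_configCell_degenerate c'.1) hc')

end PointedCells

/-! ### Passage from a CW complex with one vertex to pointed cells -/

/-- Extension of a vector by zeros. -/
def extendZero {M : ℕ} (n : ℕ) (y : Fin n → ℝ) (k : Fin M) : ℝ :=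
  if h : (k : ℕ) < n then y ⟨k, h⟩ else 0

section

open Set Metric

theorem norm_comp_castLE_le {M n : ℕ} (h : n ≤ M) (y : Fin M → ℝ) :
    ‖fun k => y (Fin.castLE h k)‖ ≤ ‖y‖ :=
  (pi_norm_le_iff_of_nonneg (norm_nonneg y)).2 fun _ => norm_le_pi_norm y _

theorem norm_extendZero_le {M n : ℕ} (y : Fin n → ℝ) : ‖(extendZero n y : Fin M → ℝ)‖ ≤ ‖y‖ := by
  refine (pi_norm_le_iff_of_nonneg (norm_nonneg y)).2 fun k => ?_
  unfold extendZero
  split_ifs with h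
  · exact norm_le_pi_norm y _
  · simp

theorem extendZero_comp_castLE {M n : ℕ} (h : n ≤ M) {y : Fin M → ℝ}
    (hy : ∀ k : Fin M, n ≤ k → y k = 0) : extendZero n (fun k => y (Fin.castLE h k)) = y := by
  ext k
  unfold extendZero
  split_ifs with hk
  · rfl
  · exact (hy k (not_lt.1 hk)).symm

theorem extendZero_castLE {M n : ℕ} (h : n ≤ M) (y : Fin n → ℝ) :
    (fun k => (extendZero n y : Fin M → ℝ) (Fin.castLE h k)) = y := by
  ext k
  simp [extendZero]

theorem extendZero_mem_coordBall {M n : ℕ} {y : Fin n → ℝ} (hy : y ∈ ball 0 1) :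
    extendZero n y ∈ coordBall M n := by
  refine ⟨fun k hk => dif_neg (by omega), (norm_extendZero_le y).trans_lt (by simpa using hy)⟩

theorem comp_castLE_mem_ball {M n : ℕ} (h : n ≤ M) {y : Fin M → ℝ} (hy : y ∈ coordBall M n) :
    (fun k => y (Fin.castLE h k)) ∈ ball (0 : Fin n → ℝ) 1 := by
  simpa using (norm_comp_castLE_le h y).trans_lt hy.2

theorem continuous_extendZero {M n : ℕ} : Continuous (extendZero n : (Fin n → ℝ) → Fin M → ℝ) := by
  refine continuous_pi fun k => ?_
  unfold extendZero
  split_ifs <;> fun_prop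

end

open Set Metric RelCWComplex in
/-- The cells of positive dimension of a finite CW complex with a single `0`-cell. -/
def CWComplex.pointedCells {X : Type*} [TopologicalSpace X] [CWComplex (univ : Set X)] {pt : X}
    (h0 : ⋃ i : cell (univ : Set X) 0, openCell 0 i = {pt}) {M : ℕ}
    (hM : ∀ n, ∀ _ : cell (univ : Set X) n, n ≤ M) :
    PointedCells X pt {c : Σ n, cell (univ : Set X) n // 0 < c.1} M where
  dim c := c.1.1
  dim_pos c := c.2
  dim_le c := hM _ c.1.2
  map c y := RelCWComplex.map c.1.1 c.1.2 fun k => y (Fin.castLE (hM _ c.1.2) k)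
  inv c p := extendZero c.1.1 ((RelCWComplex.map c.1.1 c.1.2).symm p)
  continuousOn_map c := by
    refine (RelCWComplex.continuousOn c.1.1 c.1.2).comp
      (f := fun y : Fin M → ℝ => fun k => y (Fin.castLE (hM _ c.1.2) k))
      (Continuous.continuousOn (by fun_prop)) fun y hy => ?_
    simpa using (norm_comp_castLE_le _ y).trans (by simpa using hy)
  continuousOn_inv c := by
    refine continuous_extendZero.comp_continuousOn
      ((RelCWComplex.continuousOn_symm c.1.1 c.1.2).mono ?_)
    rintro _ ⟨y, hy, rfl⟩
    refine (RelCWComplex.map c.1.1 c.1.2).map_source ?_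
    rw [RelCWComplex.source_eq]
    exact comp_castLE_mem_ball _ hy
  inv_map c y hy := by
    rw [(RelCWComplex.map c.1.1 c.1.2).left_inv (by
      rw [RelCWComplex.source_eq]
      exact comp_castLE_mem_ball _ hy)]
    exact extendZero_comp_castLE _ hy.1
  map_ne c y hy h := by
    have h1 : pt ∈ ⋃ i : cell (univ : Set X) 0, openCell 0 i := h0 ▸ rfl
    obtain ⟨i, hi⟩ := mem_iUnion.1 h1
    have h2 : pt ∈ openCell c.1.1 c.1.2 := ⟨_, comp_castLE_mem_ball (hM _ c.1.2) hy, h⟩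
    have h3 := congrArg Sigma.fst (eq_of_not_disjoint_openCell (not_disjoint_iff.2 ⟨pt, hi, h2⟩))
    exact c.2.ne h3
  eq_of_map_eq c c' y hy y' hy' h := by
    refine Subtype.ext (eq_of_not_disjoint_openCell (not_disjoint_iff.2
      ⟨_, ⟨_, comp_castLE_mem_ball (hM _ c.1.2) hy, rfl⟩, ?_⟩))
    exact ⟨_, comp_castLE_mem_ball (hM _ c'.1.2) hy', h.symm⟩
  exists_map_eq p hp := by
    have h1 : p ∈ ⋃ (n : ℕ) (j : cell (univ : Set X) n), openCell n j := by
      rw [CWComplex.iUnion_openCell_eq_complex]; trivial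
    obtain ⟨n, j, z, hz, rfl⟩ := mem_iUnion₂.1 h1
    refine ⟨⟨⟨n, j⟩, Nat.pos_of_ne_zero ?_⟩, extendZero n z, extendZero_mem_coordBall hz, ?_⟩
    · rintro rfl
      exact hp (h0.subset (mem_iUnion.2 ⟨j, z, hz, rfl⟩))
    · dsimp only
      rw [extendZero_castLE]
  map_boundary c y hy hy1 := by
    set p := RelCWComplex.map c.1.1 c.1.2 fun k => y (Fin.castLE (hM _ c.1.2) k) with hp
    have h1 : p ∈ cellFrontier c.1.1 c.1.2 := by
      refine ⟨_, ?_, rfl⟩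
      rw [mem_sphere_zero_iff_norm]
      refine le_antisymm ((norm_comp_castLE_le _ y).trans hy1.le) ?_
      rw [← hy1]
      conv_lhs => rw [← extendZero_comp_castLE (hM _ c.1.2) hy]
      exact norm_extendZero_le _
    -- The frontier is covered by open cells of smaller dimension; one of dimension 0 can only
    -- contribute the base point.
    obtain ⟨I, hI⟩ := CWComplex.cellFrontier_subset_finite_openCell c.1.1 c.1.2
    have h2 := hI h1
    simp only [mem_iUnion] at h2
    obtain ⟨n, hn, j, -, z, hz, hzp⟩ := h2
    rcases Nat.eq_zero_or_pos n with rfl | hn0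
    · exact Or.inl (h0.subset (mem_iUnion.2 ⟨j, z, hz, hzp⟩))
    · refine Or.inr ⟨⟨⟨n, j⟩, hn0⟩, hn, extendZero n z, extendZero_mem_coordBall hz, ?_⟩
      dsimp only
      rw [extendZero_castLE, hzp]

open Set Metric RelCWComplex in
theorem mainTheorem4 {U : Type*} [TopologicalSpace U] [T2Space U] [LocallyCompactSpace U]
    [CWComplex (Set.univ : Set (OnePoint U))]
    [RelCWComplex.Finite (Set.univ : Set (OnePoint U))]
    (h0 : ⋃ i : RelCWComplex.cell (Set.univ : Set (OnePoint U)) 0,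
      RelCWComplex.openCell 0 i = {∞})
    (N : Type*) [Fintype N] :
    IsConnectedPair (fatDiagonal N U) ((Fintype.card N : ℤ) - 1) ∧
    ∃ E : FiniteRelCellComplex (fatDiagonal N U),
      (∀ i, Fintype.card N ≤ E.dim i) ∧
      {C | ∃ i, E.dim i = Fintype.card N ∧ E.openCell i = C} =
        componentsOf (Conf N (unionOneCells U)) ∧
      ∀ d : ℕ, ∀ i, E.dim i = Fintype.card N + d →
        E.openCell i ⊆ Conf N (skeletonOf U (d + 1)) := by
  have hfin : _root_.Finite (Σ n, cell (univ : Set (OnePoint U)) n) :=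
    finite_iff_finite_cells.1 inferInstance
  obtain ⟨M, hM⟩ : ∃ M, ∀ n, ∀ _ : cell (univ : Set (OnePoint U)) n, n ≤ M := by
    obtain ⟨M, hM⟩ := (finite_range fun c : Σ n, cell (univ : Set (OnePoint U)) n => c.1).bddAbove
    exact ⟨M, fun n i => hM ⟨⟨n, i⟩, rfl⟩⟩
  let S := CWComplex.pointedCells h0 hM
  have hS1 : S.oneCells = unionOneCells U := by
    ext p
    simp only [PointedCells.oneCells, unionOneCells, mem_iUnion]
    constructor
    · rintro ⟨⟨⟨n, i⟩, hn⟩, h1, y, hy, rfl⟩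
      obtain rfl : n = 1 := h1
      exact ⟨i, _, comp_castLE_mem_ball _ hy, rfl⟩
    · rintro ⟨i, z, hz, rfl⟩
      refine ⟨⟨⟨1, i⟩, one_pos⟩, rfl, extendZero 1 z, extendZero_mem_coordBall hz, ?_⟩
      exact congrArg (RelCWComplex.map 1 i) (extendZero_castLE (hM 1 i) z)
  have hex := S.exists_finiteRelCellComplex (N := N)
  rw [show PointedCells.degenerate ∞ N = fatDiagonal N U from rfl] at hex
  obtain ⟨E, e, hE⟩ := hex
  have hdim : ∀ i, Fintype.card N ≤ E.dim i := fun i => (hE i).1 ▸ S.card_le_finrank (e i)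
  refine ⟨E.isConnectedPair fun i => ?_, E, hdim, ?_, ?_⟩
  · have := hdim i
    omega
  · rw [← hS1, S.componentsOf_conf_oneCells]
    ext K
    constructor
    · rintro ⟨i, hi, rfl⟩
      exact ⟨e i, (hE i).1 ▸ hi, (hE i).2.symm⟩
    · rintro ⟨c, hc, rfl⟩
      obtain ⟨i, rfl⟩ := e.surjective c
      exact ⟨i, (hE i).1.trans hc, (hE i).2⟩
  · intro d i hi f hf
    rw [(hE i).2] at hf
    rw [(hE i).1] at hi
    refine ⟨S.injective_of_mem_configCell hf, fun a => ?_⟩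
    obtain ⟨x, hx, -, rfl⟩ := hf
    have h1 := S.card_add_dim_le_finrank (e i) a
    set c := (e i).1.1 a with hc
    -- Comparing `n + dim c - 1` with the dimension `n + d` of the configuration cell bounds every
    -- occupied cell.
    have h2 : S.dim c ≤ d + 1 := by omega
    refine ⟨?_, S.map_ne _ _ (hx.1 a)⟩
    refine skeleton_mono (n := ((d + 1 : ℕ) : ℕ∞)) (Nat.cast_le.2 h2) ?_
    exact openCell_subset_skeleton c.1.1 c.1.2 ⟨_, comp_castLE_mem_ball _ (hx.1 a), rfl⟩
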